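/- For a set $D$ let $B(D)$ be the space of all bounded functions $f\colon D\to\mathbb{C}$ with the norm $\|f\|_\infty=\sup_{x\in D}|f(x)|$. For a finite multiset $X$ of points of $D$ put $\|f\|_X=\bigl(\frac{1}{|X|}\sum_{x\in X}|f(x)|^2\bigr)^{1/2}$ (points counted with multiplicity), and for a finite-dimensional subspace $V\subset B(D)$ let $A(X,V)f:=\operatorname{argmin}_{g\in V}\|g-f\|_X$ denote the unweighted least-squares algorithm. There is a universal constant $C>0$ such that the following holds. Let $D$ be a set, let $n\ge 1$, and let $V_n$ be an $n$-dimensional complex linear subspace of $B(D)$. Then there exists a finite multiset $X$ of points of $D$, of cardinality at most $2n$ counted with multiplicity, such that $A(X,V_n)$ is a well-defined linear operator on $B(D)$ (that is, for every $f\in B(D)$ the minimizer of $\|g-f\|_X$ over $g\in V_n$ exists and is unique, and it depends linearly on $f$), and, for all $f\in B(D)$, $$\|f-A(X,V_n)f\|_\infty\le C\sqrt{n}\cdot\inf_{g\in V_n}\|f-g\|_\infty .$$ -/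

import Mathlib

/-- `B(D)`: the space of all bounded complex-valued functions on a set `D`, with the norm
`‖f‖ = sup_{x ∈ D} |f x|`. No structure on `D` is assumed. -/
abbrev BoundedFun (D : Type*) : Type _ := lp (fun _ : D => ℂ) ⊤

/-- The discrete `ℓ₂`-seminorm `‖f‖_X = (|X|⁻¹ ∑_{x ∈ X} |f x|²)^{1/2}` of a bounded function with
respect to a finite multiset `X` of points; the sum respects multiplicities. -/
noncomputable def discreteNorm {D : Type*} (X : Multiset D) (f : BoundedFun D) : ℝ :=
  Real.sqrt ((Multiset.card X : ℝ)⁻¹ * (X.map fun x => ‖f x‖ ^ 2).sum)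

/-- `g ∈ V` is a least-squares fit of `f` on `X`, i.e. it minimizes `‖g - f‖_X` over `V`. -/
def IsLeastSquaresFit {D : Type*} (X : Multiset D) (V : Submodule ℂ (BoundedFun D))
    (f : BoundedFun D) (g : V) : Prop :=
  ∀ h : V, discreteNorm X ((g : BoundedFun D) - f) ≤ discreteNorm X ((h : BoundedFun D) - f)

/-- The unweighted least-squares algorithm `A(X, V) : B(D) → V`,
`A(X, V) f = argmin_{g ∈ V} ‖g - f‖_X`. -/
noncomputable def leastSquares {D : Type*} (X : Multiset D) (V : Submodule ℂ (BoundedFun D))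
    (f : BoundedFun D) : V :=
  Classical.epsilon (IsLeastSquaresFit X V f)

/-! Take 2n nodes whose information matrix `M = ∑ v vᴴ` nearly maximizes the determinant; the
supremum need not be attained. Exchanging one node for `y` cannot raise the determinant above the
supremum, and averaging this over all nodes gives `v(y)ᴴ M⁻¹ v(y) ≤ 1` for every `y`. By
Cauchy–Schwarz, the sup norm on `V` is at most the ℓ₂ norm of the samples
(`exists_design_norm_sq_le`). Least squares is an orthogonal projection in sample space and fixes
`V`, so its error is at most `1 + √(2n)` times that of any `g ∈ V`. -/

/-! ### Nearly D-optimal designs and the exchange argument. -/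

section Design

open Matrix
open scoped ComplexOrder

variable {D κ ι : Type*} [Fintype ι]

/-- The information matrix `∑ k, v (p k) (v (p k))ᴴ` of the design `p`. -/
noncomputable def infoMatrix (v : D → κ → ℂ) (p : ι → D) : Matrix κ κ ℂ :=
  (of fun i k => v (p k) i) * (of fun i k => v (p k) i)ᴴ

theorem infoMatrix_apply (v : D → κ → ℂ) (p : ι → D) (i j : κ) :
    infoMatrix v p i j = ∑ k, v (p k) i * star (v (p k) j) := by
  simp [infoMatrix, mul_apply]

theorem posSemidef_infoMatrix [Fintype κ] (v : D → κ → ℂ) (p : ι → D) :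
    (infoMatrix v p).PosSemidef :=
  posSemidef_self_mul_conjTranspose _

/-- An exchange is a rank-two perturbation, so the determinant lemma reduces its effect to a 2 × 2
determinant. -/
theorem infoMatrix_update [DecidableEq ι] (v : D → κ → ℂ) (p : ι → D) (k : ι) (y : D) :
    infoMatrix v (Function.update p k y) = infoMatrix v p +
      (of fun i (j : Fin 2) => ![-v (p k) i, v y i] j) *
        (of fun (j : Fin 2) i => ![star (v (p k) i), star (v y i)] j) := by
  ext i j
  simp only [infoMatrix_apply, Matrix.add_apply, mul_apply, of_apply, Fin.sum_univ_two]
  rw [← Finset.add_sum_erase _ _ (Finset.mem_univ k),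
    ← Finset.add_sum_erase Finset.univ (fun k => v (p k) i * star (v (p k) j)) (Finset.mem_univ k)]
  have : ∀ l ∈ Finset.univ.erase k, v (Function.update p k y l) i *
      star (v (Function.update p k y l) j) = v (p l) i * star (v (p l) j) := by
    intro l hl
    rw [Function.update_of_ne (Finset.ne_of_mem_erase hl)]
  rw [Finset.sum_congr rfl this]
  simp
  ring

variable [Fintype κ] [DecidableEq κ]

/-- The sesquilinear form given by the inverse of the information matrix. -/
noncomputable def infoForm (v : D → κ → ℂ) (p : ι → D) (x y : D) : ℂ :=
  star (v x) ⬝ᵥ ((infoMatrix v p)⁻¹ *ᵥ v y)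

theorem det_infoMatrix_eq_ofReal (v : D → κ → ℂ) (p : ι → D) :
    (infoMatrix v p).det = ((infoMatrix v p).det.re : ℂ) := by
  have h := (Complex.le_def.1 (posSemidef_infoMatrix v p).det_nonneg).2
  apply Complex.ext <;> simp
  simpa using h.symm

theorem star_infoForm (v : D → κ → ℂ) (p : ι → D) (x y : D) :
    star (infoForm v p x y) = infoForm v p y x := by
  have h : ((infoMatrix v p)⁻¹)ᴴ = (infoMatrix v p)⁻¹ :=
    (posSemidef_infoMatrix v p).isHermitian.inv
  rw [infoForm, ← star_dotProduct, star_mulVec, h, ← dotProduct_mulVec, infoForm]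

theorem det_infoMatrix_update [DecidableEq ι] {v : D → κ → ℂ} {p : ι → D}
    (hp : IsUnit (infoMatrix v p).det)
    (k : ι) (y : D) :
    (infoMatrix v (Function.update p k y)).det = (infoMatrix v p).det *
      ((1 - infoForm v p (p k) (p k)) * (1 + infoForm v p y y) +
        infoForm v p y (p k) * infoForm v p (p k) y) := by
  have key : ∀ a b : κ → ℂ, ∑ j, (∑ i, star (a i) * (infoMatrix v p)⁻¹ i j) * b j =
      star a ⬝ᵥ ((infoMatrix v p)⁻¹ *ᵥ b) := by
    intro a b
    rw [dotProduct_mulVec]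
    rfl
  rw [infoMatrix_update, det_add_mul _ _ hp, det_fin_two]
  simp only [Matrix.add_apply, mul_apply, of_apply, cons_val_zero, cons_val_one, one_apply_eq,
    mul_neg, Finset.sum_neg_distrib, key, ne_eq, zero_ne_one, one_ne_zero, not_false_eq_true,
    one_apply_ne, infoForm]
  ring

/-- The sum is the trace of `M⁻¹ M`. -/
theorem sum_infoForm_self {v : D → κ → ℂ} {p : ι → D} (hp : IsUnit (infoMatrix v p).det) :
    ∑ k, infoForm v p (p k) (p k) = Fintype.card κ := by
  rw [← trace_one (R := ℂ) (n := κ), ← nonsing_inv_mul _ hp, trace]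
  simp only [infoForm, dotProduct, mulVec, diag, mul_apply, infoMatrix_apply, Finset.mul_sum]
  rw [Finset.sum_comm]
  refine Finset.sum_congr rfl fun i _ => ?_
  rw [Finset.sum_comm]
  refine Finset.sum_congr rfl fun j _ => Finset.sum_congr rfl fun k _ => ?_
  simp
  ring

/-- This is `M M⁻¹ v(y) = v(y)` with `M` expanded over the nodes. -/
theorem sum_infoForm_smul {v : D → κ → ℂ} {p : ι → D} (hp : IsUnit (infoMatrix v p).det)
    (y : D) : ∑ k, infoForm v p (p k) y • v (p k) = v y := by
  conv_rhs => rw [← one_mulVec (v y), ← mul_nonsing_inv _ hp, ← mulVec_mulVec]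
  ext i
  simp only [infoForm, dotProduct, Finset.sum_apply, Pi.smul_apply, smul_eq_mul, Finset.sum_mul,
    mulVec.eq_1 (infoMatrix v p), infoMatrix_apply]
  rw [Finset.sum_comm]
  refine Finset.sum_congr rfl fun j _ => Finset.sum_congr rfl fun k _ => ?_
  simp
  ring

theorem infoForm_self {v : D → κ → ℂ} {p : ι → D} (hp : IsUnit (infoMatrix v p).det) (y : D) :
    infoForm v p y y = ((∑ k, ‖infoForm v p (p k) y‖ ^ 2 : ℝ) : ℂ) := by
  conv_lhs => rw [infoForm]
  nth_rewrite 2 [← sum_infoForm_smul hp y]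
  rw [mulVec_sum, dotProduct_sum, Complex.ofReal_sum]
  refine Finset.sum_congr rfl fun k _ => ?_
  rw [mulVec_smul, dotProduct_smul, smul_eq_mul]
  change _ * infoForm v p y (p k) = _
  rw [← star_infoForm v p (p k) y]
  simp [Complex.mul_conj, Complex.normSq_eq_norm_sq]

/-- After summing over the exchanged node, the trace identity and `infoForm_self` leave only `r =
v(y)ᴴ M⁻¹ v(y)`. -/
theorem sum_det_infoMatrix_update [DecidableEq ι] {v : D → κ → ℂ} {p : ι → D}
    (hp : IsUnit (infoMatrix v p).det) (y : D) :
    ∑ k, (infoMatrix v (Function.update p k y)).det.re = (infoMatrix v p).det.re *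
      ((Fintype.card ι - Fintype.card κ) * (1 + ∑ k, ‖infoForm v p (p k) y‖ ^ 2) +
        ∑ k, ‖infoForm v p (p k) y‖ ^ 2) := by
  have h : ∑ k, (infoMatrix v (Function.update p k y)).det = (infoMatrix v p).det *
      ((Fintype.card ι - Fintype.card κ) * (1 + infoForm v p y y) + infoForm v p y y) := by
    simp only [det_infoMatrix_update hp, ← Finset.mul_sum, Finset.sum_add_distrib,
      ← Finset.sum_mul, Finset.sum_sub_distrib, sum_infoForm_self hp]
    congr 2
    · simp
    · rw [infoForm_self hp, Complex.ofReal_sum]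
      refine Finset.sum_congr rfl fun k _ => ?_
      rw [← star_infoForm v p (p k) y]
      simp [Complex.conj_mul']
  rw [det_infoMatrix_eq_ofReal v p, infoForm_self hp] at h
  have := congrArg Complex.re h
  rw [Complex.re_sum] at this
  rw [this]
  norm_cast

/-- Cauchy–Schwarz applied to the expansion of `v y` over the nodes. -/
theorem norm_sq_dotProduct_le {v : D → κ → ℂ} {p : ι → D} (hp : IsUnit (infoMatrix v p).det)
    (c : κ → ℂ) (y : D) :
    ‖c ⬝ᵥ v y‖ ^ 2 ≤ (∑ k, ‖infoForm v p (p k) y‖ ^ 2) * ∑ k, ‖c ⬝ᵥ v (p k)‖ ^ 2 := by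
  have h : ‖c ⬝ᵥ v y‖ ≤ ∑ k, ‖infoForm v p (p k) y‖ * ‖c ⬝ᵥ v (p k)‖ := by
    nth_rewrite 1 [← sum_infoForm_smul hp y]
    rw [dotProduct_sum]
    refine (norm_sum_le _ _).trans_eq (Finset.sum_congr rfl fun k _ => ?_)
    rw [dotProduct_smul, norm_smul]
  exact (pow_le_pow_left₀ (norm_nonneg _) h 2).trans (Finset.sum_mul_sq_le_sq_mul_sq _ _ _)

theorem bddAbove_det_infoMatrix {v : D → κ → ℂ} {B : ℝ} (hB : ∀ x i, ‖v x i‖ ≤ B) :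
    BddAbove (Set.range fun p : ι → D => (infoMatrix v p).det.re) := by
  refine ⟨(Fintype.card κ).factorial • (Fintype.card ι * (B * B)) ^ Fintype.card κ, ?_⟩
  rintro _ ⟨p, rfl⟩
  refine (Complex.re_le_norm _).trans ?_
  refine det_le (abv := NormedField.toAbsoluteValue ℂ) fun i j => ?_
  change ‖infoMatrix v p i j‖ ≤ _
  rw [infoMatrix_apply]
  have hcard : Fintype.card ι * (B * B) = ∑ _k : ι, B * B := by simp
  rw [hcard]
  refine norm_sum_le_of_le _ fun k _ => ?_
  rw [norm_mul, norm_star]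
  exact mul_le_mul (hB _ _) (hB _ _) (norm_nonneg _) ((norm_nonneg _).trans (hB (p k) i))

theorem span_range_eq_top_of_dotProduct {v : D → κ → ℂ}
    (hv : ∀ c : κ → ℂ, (∀ x, c ⬝ᵥ v x = 0) → c = 0) :
    Submodule.span ℂ (Set.range v) = ⊤ := by
  by_contra h
  obtain ⟨f, hf, hle⟩ := Submodule.exists_le_ker_of_lt_top _ (lt_top_iff_ne_top.2 h)
  have hfc : ∀ w, f w = (fun i => f (Pi.single i 1)) ⬝ᵥ w := by
    intro w
    rw [LinearMap.pi_apply_eq_sum_univ f w, dotProduct]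
    refine Finset.sum_congr rfl fun i _ => ?_
    rw [smul_eq_mul, mul_comm]
    congr 2
    ext j
    simp [Pi.single_apply, eq_comm]
  refine hf (LinearMap.ext fun w => ?_)
  rw [hfc, hv (fun i => f (Pi.single i 1)) fun x => ?_]
  · simp
  · rw [← hfc]
    exact hle (Submodule.subset_span ⟨x, rfl⟩)

theorem exists_det_infoMatrix_pos {v : D → κ → ℂ}
    (hv : ∀ c : κ → ℂ, (∀ x, c ⬝ᵥ v x = 0) → c = 0) :
    ∃ p : κ ⊕ κ → D, 0 < (infoMatrix v p).det.re := by
  obtain ⟨g, hg, hspan, -⟩ := Submodule.exists_fun_fin_finrank_span_eq ℂ (Set.range v)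
  have htop := span_range_eq_top_of_dotProduct hv
  choose q hq using hg
  have hcard : Module.finrank ℂ (Submodule.span ℂ (Set.range v)) = Fintype.card κ := by
    rw [htop, finrank_top, Module.finrank_fintype_fun_eq_card]
  let e : κ ≃ Fin (Module.finrank ℂ (Submodule.span ℂ (Set.range v))) :=
    Fintype.equivFinOfCardEq hcard.symm
  -- The n spanning nodes already suffice; repeating them fills the 2n slots.
  refine ⟨Sum.elim (q ∘ e) (q ∘ e), ?_⟩
  have hpos : (infoMatrix v (Sum.elim (q ∘ e) (q ∘ e))).PosDef := by
    refine PosDef.mul_conjTranspose_self _ ?_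
    rw [← coe_vecMulLinear, injective_iff_map_eq_zero]
    intro c hc
    have hc' : ∀ i, c ⬝ᵥ g i = 0 := by
      intro i
      have := congrFun hc (Sum.inl (e.symm i))
      rw [← hq]
      simpa [vecMul, dotProduct] using this
    refine hv c fun x => ?_
    have hx : v x ∈ Submodule.span ℂ (Set.range g) := by rw [hspan, htop]; trivial
    generalize v x = w at hx
    induction hx using Submodule.span_induction with
    | mem _ h => obtain ⟨i, rfl⟩ := h; exact hc' i
    | zero => simp
    | add a b _ _ ha hb => rw [dotProduct_add, ha, hb, add_zero]
    | smul a b _ hb => rw [dotProduct_smul, hb, smul_zero]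
  exact (Complex.lt_def.1 hpos.det_pos).1

/-- A nearly D-optimal design with `2 * card κ` nodes dominates the supremum norm. -/
theorem exists_design_norm_sq_le {v : D → κ → ℂ} {B : ℝ} (hB : ∀ x i, ‖v x i‖ ≤ B)
    (hv : ∀ c : κ → ℂ, (∀ x, c ⬝ᵥ v x = 0) → c = 0) :
    ∃ p : κ ⊕ κ → D, ∀ (c : κ → ℂ) (y : D), ‖c ⬝ᵥ v y‖ ^ 2 ≤ ∑ k, ‖c ⬝ᵥ v (p k)‖ ^ 2 := by
  have hbdd := bddAbove_det_infoMatrix (ι := κ ⊕ κ) hB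
  obtain ⟨p₀, hp₀⟩ := exists_det_infoMatrix_pos hv
  set s := ⨆ p : κ ⊕ κ → D, (infoMatrix v p).det.re with hs
  have hspos : 0 < s := hp₀.trans_le (le_ciSup hbdd p₀)
  set N : ℝ := (Fintype.card κ : ℝ) with hN
  have hN0 : 0 ≤ N := Nat.cast_nonneg _
  have : Nonempty (κ ⊕ κ → D) := ⟨p₀⟩
  -- The factor `2N / (2N + 1)` is the loss from optimality that still yields `r < 1` below.
  have hlt : s * (2 * N / (2 * N + 1)) < s := by
    refine mul_lt_of_lt_one_right hspos ?_
    rw [div_lt_one (by positivity)]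
    linarith
  obtain ⟨p, hp⟩ := exists_lt_of_lt_ciSup hlt
  have hdet : 0 < (infoMatrix v p).det.re := lt_of_le_of_lt (by positivity) hp
  have hunit : IsUnit (infoMatrix v p).det := by
    rw [isUnit_iff_ne_zero]
    intro h
    simp [h] at hdet
  refine ⟨p, fun c y => (norm_sq_dotProduct_le hunit c y).trans ?_⟩
  refine mul_le_of_le_one_left (Finset.sum_nonneg fun _ _ => by positivity) ?_
  set r := ∑ k, ‖infoForm v p (p k) y‖ ^ 2 with hr
  have hsum : (infoMatrix v p).det.re * (N * (1 + r) + r) ≤ 2 * N * s := by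
    have h := sum_det_infoMatrix_update hunit y
    have h' : ∑ k, (infoMatrix v (Function.update p k y)).det.re ≤ ∑ _k : κ ⊕ κ, s :=
      Finset.sum_le_sum fun k _ => le_ciSup hbdd (Function.update p k y)
    simp only [Finset.sum_const, Finset.card_univ, Fintype.card_sum, nsmul_eq_mul,
      Nat.cast_add] at h h'
    rw [h, ← hr, ← hN] at h'
    linarith
  have hle : 2 * N * s < (infoMatrix v p).det.re * (2 * N + 1) := by
    rw [← mul_div_assoc, div_lt_iff₀ (by positivity)] at hp
    linarith
  have := lt_of_mul_lt_mul_left (hsum.trans_lt hle) hdet.le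
  -- `N(1 + r) + r < 2N + 1` says `(N + 1) r < N + 1`.
  nlinarith

end Design

/-! ### Least squares as an orthogonal projection of samples. -/

section LeastSquares

variable {D ι : Type*} [Fintype ι]

/-- Sampling of a bounded function at the points `p k`. -/
noncomputable def sampling (p : ι → D) : BoundedFun D →ₗ[ℂ] EuclideanSpace ℂ ι where
  toFun f := WithLp.toLp 2 fun k => f (p k)
  map_add' _ _ := rfl
  map_smul' _ _ := rfl

theorem norm_sampling_sq (p : ι → D) (f : BoundedFun D) :
    ‖sampling p f‖ ^ 2 = ∑ k, ‖f (p k)‖ ^ 2 :=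
  EuclideanSpace.norm_sq_eq _

theorem norm_sampling_le (p : ι → D) (f : BoundedFun D) :
    ‖sampling p f‖ ≤ Real.sqrt (Fintype.card ι) * ‖f‖ := by
  refine (sq_le_sq₀ (norm_nonneg _) (by positivity)).1 ?_
  rw [norm_sampling_sq, mul_pow, Real.sq_sqrt (Nat.cast_nonneg _)]
  refine (Finset.sum_le_sum fun k _ => pow_le_pow_left₀ (norm_nonneg _)
    (lp.norm_apply_le_norm ENNReal.top_ne_zero f (p k)) 2).trans_eq ?_
  simp

theorem discreteNorm_map (p : ι → D) (f : BoundedFun D) :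
    discreteNorm (Finset.univ.val.map p) f =
      Real.sqrt ((Fintype.card ι : ℝ)⁻¹) * ‖sampling p f‖ := by
  have h : ((Finset.univ.val.map p).map fun x => ‖f x‖ ^ 2).sum = ‖sampling p f‖ ^ 2 := by
    rw [norm_sampling_sq, Multiset.map_map]
    rfl
  rw [discreteNorm, h, Real.sqrt_mul (by positivity), Real.sqrt_sq (norm_nonneg _)]
  simp

/-- Least squares from the data `S f`, for a subspace `V` on which `S` is injective. -/
noncomputable def leastSquaresMap {F E : Type*} [AddCommGroup F] [Module ℂ F]
    [NormedAddCommGroup E] [InnerProductSpace ℂ E] [FiniteDimensional ℂ E] (S : F →ₗ[ℂ] E)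
    (V : Submodule ℂ F) (h : Function.Injective (S.domRestrict V)) : F →ₗ[ℂ] V :=
  (LinearEquiv.ofInjective _ h).symm.toLinearMap ∘ₗ
    (LinearMap.range (S.domRestrict V)).orthogonalProjectionOnto.toLinearMap ∘ₗ S

section

variable {F E : Type*} [AddCommGroup F] [Module ℂ F]
  [NormedAddCommGroup E] [InnerProductSpace ℂ E] [FiniteDimensional ℂ E] (S : F →ₗ[ℂ] E)
  (V : Submodule ℂ F) (h : Function.Injective (S.domRestrict V))

theorem apply_leastSquaresMap (f : F) :
    S (leastSquaresMap S V h f) =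
      (LinearMap.range (S.domRestrict V)).starProjection (S f) :=
  congrArg Subtype.val ((LinearEquiv.ofInjective _ h).apply_symm_apply
    ((LinearMap.range (S.domRestrict V)).orthogonalProjectionOnto (S f)))

theorem norm_apply_leastSquaresMap_le (f : F) : ‖S (leastSquaresMap S V h f)‖ ≤ ‖S f‖ := by
  rw [apply_leastSquaresMap]
  exact Submodule.norm_starProjection_apply_le _ _

theorem leastSquaresMap_coe (g : V) : leastSquaresMap S V h g = g := by
  apply h
  change S (leastSquaresMap S V h g) = S g
  rw [apply_leastSquaresMap, Submodule.starProjection_eq_self_iff]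
  exact ⟨g, rfl⟩

/-- By Pythagoras, the minimizers are the elements whose samples equal the projection of `S f`;
injectivity leaves exactly one. -/
theorem forall_norm_apply_sub_le_iff (f : F) (g : V) :
    (∀ w : V, ‖S g - S f‖ ≤ ‖S w - S f‖) ↔ g = leastSquaresMap S V h f := by
  set W := LinearMap.range (S.domRestrict V) with hW
  have hpyth : ∀ w : V, ‖S w - S f‖ ^ 2 =
      ‖S w - W.starProjection (S f)‖ ^ 2 + ‖W.starProjection (S f) - S f‖ ^ 2 := by
    intro w
    rw [← sub_add_sub_cancel _ (W.starProjection (S f)) (S f), pow_two, pow_two, pow_two]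
    refine norm_add_sq_eq_norm_sq_add_norm_sq_of_inner_eq_zero (𝕜 := ℂ) _ _ ?_
    rw [← neg_sub (S f), inner_neg_right, neg_eq_zero]
    exact W.sub_starProjection_mem_orthogonal _ _
      (W.sub_mem ⟨w, rfl⟩ (W.starProjection_apply_mem _))
  constructor
  · intro hg
    apply h
    change S g = S (leastSquaresMap S V h f)
    have h1 := pow_le_pow_left₀ (norm_nonneg _) (hg (leastSquaresMap S V h f)) 2
    rw [hpyth, hpyth, apply_leastSquaresMap, sub_self, norm_zero] at h1
    rw [apply_leastSquaresMap, ← sub_eq_zero, ← norm_eq_zero, ← sq_eq_zero_iff]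
    exact le_antisymm (by linarith) (sq_nonneg _)
  · rintro rfl w
    refine (sq_le_sq₀ (norm_nonneg _) (norm_nonneg _)).1 ?_
    rw [hpyth, hpyth w, apply_leastSquaresMap, sub_self, norm_zero]
    have := sq_nonneg ‖S w - W.starProjection (S f)‖
    linarith

end

theorem isLeastSquaresFit_iff [Nonempty ι] (p : ι → D) (V : Submodule ℂ (BoundedFun D))
    (h : Function.Injective ((sampling p).domRestrict V)) (f : BoundedFun D) (g : V) :
    IsLeastSquaresFit (Finset.univ.val.map p) V f g ↔ g = leastSquaresMap (sampling p) V h f := by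
  have hpos : 0 < Real.sqrt ((Fintype.card ι : ℝ)⁻¹) := by positivity
  rw [← forall_norm_apply_sub_le_iff]
  simp only [IsLeastSquaresFit, discreteNorm_map, map_sub, mul_le_mul_iff_right₀ hpos]

theorem leastSquares_eq [Nonempty ι] (p : ι → D) (V : Submodule ℂ (BoundedFun D))
    (h : Function.Injective ((sampling p).domRestrict V)) (f : BoundedFun D) :
    leastSquares (Finset.univ.val.map p) V f = leastSquaresMap (sampling p) V h f := by
  rw [← isLeastSquaresFit_iff]
  exact Classical.epsilon_spec ⟨_, (isLeastSquaresFit_iff p V h f _).2 rfl⟩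

/-- Elements of `V` are reproduced, so `f` may be replaced by `f - g` in the error. -/
theorem norm_sub_leastSquaresMap_le (p : ι → D) (V : Submodule ℂ (BoundedFun D))
    (h : Function.Injective ((sampling p).domRestrict V))
    (hV : ∀ g : V, ‖(g : BoundedFun D)‖ ≤ ‖sampling p g‖) (f : BoundedFun D) (g : V) :
    ‖f - leastSquaresMap (sampling p) V h f‖ ≤
      (1 + Real.sqrt (Fintype.card ι)) * ‖f - (g : BoundedFun D)‖ := by
  have h1 : f - leastSquaresMap (sampling p) V h f =
      (f - (g : BoundedFun D)) - leastSquaresMap (sampling p) V h (f - (g : BoundedFun D)) := by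
    rw [map_sub, leastSquaresMap_coe, Submodule.coe_sub]
    abel
  have h2 : ‖(leastSquaresMap (sampling p) V h (f - (g : BoundedFun D)) : BoundedFun D)‖ ≤
      Real.sqrt (Fintype.card ι) * ‖f - (g : BoundedFun D)‖ := by
    exact (hV _).trans
      ((norm_apply_leastSquaresMap_le _ V h _).trans (norm_sampling_le p _))
  rw [h1, add_mul, one_mul]
  exact (norm_sub_le _ _).trans (by gcongr)

/-- Every `n`-dimensional space of bounded functions admits `2 * n` nodes whose samples dominate
the supremum norm. -/
theorem exists_nodes_norm_le_norm_sampling {n : ℕ} (V : Submodule ℂ (BoundedFun D))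
    [FiniteDimensional ℂ V] (hn : Module.finrank ℂ V = n) :
    ∃ p : Fin n ⊕ Fin n → D, ∀ g : V, ‖(g : BoundedFun D)‖ ≤ ‖sampling p g‖ := by
  have : Module.Free ℂ V := Module.Free.of_divisionRing ℂ V
  let b : Module.Basis (Fin n) ℂ V := Module.finBasisOfFinrankEq ℂ V hn
  let v : D → Fin n → ℂ := fun x i => (b i : BoundedFun D) x
  have hsum : ∀ (c : Fin n → ℂ) (x : D),
      ((∑ i, c i • b i : V) : BoundedFun D) x = dotProduct c (v x) := by
    intro c x
    let ev : V →ₗ[ℂ] ℂ :=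
      { toFun := fun g => (g : BoundedFun D) x
        map_add' := fun _ _ => rfl
        map_smul' := fun _ _ => rfl }
    exact (map_sum ev _ _).trans (Finset.sum_congr rfl fun i _ => map_smul ev (c i) (b i))
  have hB : ∀ x i, ‖v x i‖ ≤ ∑ j, ‖(b j : BoundedFun D)‖ := fun x i =>
    (lp.norm_apply_le_norm ENNReal.top_ne_zero _ x).trans
      (Finset.single_le_sum (f := fun j => ‖(b j : BoundedFun D)‖)
        (fun _ _ => norm_nonneg _) (Finset.mem_univ i))
  have hv : ∀ c : Fin n → ℂ, (∀ x, dotProduct c (v x) = 0) → c = 0 := by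
    intro c hc
    have h0 : ∑ i, c i • b i = 0 := by
      apply Subtype.ext
      apply lp.ext
      funext x
      rw [hsum, hc]
      rfl
    exact funext (Fintype.linearIndependent_iff.1 b.linearIndependent c h0)
  obtain ⟨p, hp⟩ := exists_design_norm_sq_le hB hv
  refine ⟨p, fun g => lp.norm_le_of_forall_le (norm_nonneg _) fun y => ?_⟩
  refine (sq_le_sq₀ (norm_nonneg _) (norm_nonneg _)).1 ?_
  have h := hp (b.repr g) y
  simp only [← hsum, b.sum_repr] at h
  rwa [norm_sampling_sq]

end LeastSquares

/-! ### The main theorem. -/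

theorem theorem3 :
    ∃ C : ℝ, 0 < C ∧
      ∀ (D : Type*) (n : ℕ) (V : Submodule ℂ (BoundedFun D)),
        1 ≤ n → Module.finrank ℂ V = n →
          ∃ X : Multiset D, Multiset.card X ≤ 2 * n ∧
            -- the least-squares algorithm is a well-defined linear operator
            (∀ f : BoundedFun D, ∃! g : V, IsLeastSquaresFit X V f g) ∧
            IsLinearMap ℂ (leastSquares X V) ∧
            ∀ f : BoundedFun D,
              ‖f - (leastSquares X V f : BoundedFun D)‖ ≤
                C * Real.sqrt n * ⨅ g : V, ‖f - (g : BoundedFun D)‖ := by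
  refine ⟨3, by norm_num, fun D n V hn hV => ?_⟩
  have : Module.Free ℂ V := Module.Free.of_divisionRing ℂ V
  -- `finrank` is 0 in infinite dimension, so `1 ≤ n` forces finiteness.
  have : FiniteDimensional ℂ V := Module.finite_of_finrank_pos (by lia)
  have : Nonempty (Fin n ⊕ Fin n) := ⟨Sum.inl ⟨0, hn⟩⟩
  obtain ⟨p, hp⟩ := exists_nodes_norm_le_norm_sampling V hV
  have hinj : Function.Injective ((sampling p).domRestrict V) := by
    rw [injective_iff_map_eq_zero]
    intro g hg
    have h := hp g
    rw [show sampling p g = 0 from hg, norm_zero, norm_le_zero_iff] at h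
    exact Subtype.ext h
  refine ⟨Finset.univ.val.map p, ?_, fun f => ?_, ?_, fun f => ?_⟩
  · rw [Multiset.card_map, Finset.card_val, Finset.card_univ, Fintype.card_sum, Fintype.card_fin,
      two_mul]
  · exact ⟨_, (isLeastSquaresFit_iff p V hinj f _).2 rfl,
      fun g hg => (isLeastSquaresFit_iff p V hinj f g).1 hg⟩
  · rw [funext (leastSquares_eq p V hinj)]
    exact (leastSquaresMap (sampling p) V hinj).isLinear
  · rw [leastSquares_eq p V hinj, Real.mul_iInf_of_nonneg (by positivity)]
    refine le_ciInf fun g => (norm_sub_leastSquaresMap_le p V hinj hp f g).trans ?_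
    refine mul_le_mul_of_nonneg_right ?_ (norm_nonneg _)
    have h1 : (1 : ℝ) ≤ n := by exact_mod_cast hn
    have h2 : 1 ≤ Real.sqrt n := Real.one_le_sqrt.2 h1
    -- The constant 3 comes from `1 + √(2n) ≤ √n + 2√n`.
    have h3 : Real.sqrt (Fintype.card (Fin n ⊕ Fin n)) ≤ 2 * Real.sqrt n := by
      rw [Real.sqrt_le_left (by positivity), mul_pow, Real.sq_sqrt (by positivity)]
      simp
      linarith
    linarith
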